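/- Let $m\le n$ be integers, let $p_{m-1},p_m,\dots,p_n\in(0,1)$ and put $q_i=1-p_i$. Consider the exclusion process on $[m,n]=\{m,\dots,n\}$ with open boundaries, that is, the continuous time Markov chain on $\{0,1\}^{[m,n]}$ with the following transitions: for $m\le i<n$, a particle at $i$ jumps to $i+1$ at rate $p_i$ if $i+1$ is vacant, and a particle at $i+1$ jumps to $i$ at rate $q_{i+1}$ if $i$ is vacant; if $m$ is vacant, a particle enters at $m$ at rate $p_{m-1}$; if $n$ is occupied, the particle at $n$ leaves at rate $p_n$. This chain has a unique stationary distribution $\mu_{m,n}$. The flux $$\phi(\mu_{m,n})=p_k\,\mu_{m,n}\{\eta:\eta(k)=1,\ \eta(k+1)=0\}-q_{k+1}\,\mu_{m,n}\{\eta:\eta(k)=0,\ \eta(k+1)=1\}$$ does not depend on $k$ with $m\le k<n$, and it also equals the entrance rate $p_{m-1}\,\mu_{m,n}\{\eta:\eta(m)=0\}$ and the exit rate $p_n\,\mu_{m,n}\{\eta:\eta(n)=1\}$ (which define it if $m=n$). The flux $\phi(\mu_{m,n})$ is an increasing (that is, nondecreasing) function of $p_{m-1},p_m,\dots,p_n$: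 if $p_i\le p_i'$ for all $m-1\le i\le n$, with all $p_i,p_i'\in(0,1)$, then $\phi(\mu_{m,n})\le\phi(\mu_{m,n}')$, where $\mu_{m,n}'$ is the stationary distribution for the probabilities $p_i'$. -/

import Mathlib

namespace OpenExclusion

/-- Particle configurations on the integer interval `[m, n]`: `η i = true` means that the site `i`
is occupied, `η i = false` that it is vacant. -/
abbrev Config (m n : ℤ) : Type := Finset.Icc m n → Bool

/-- The state of the site `k` in `η`. Outside `[m, n]` we use the convention that suits the boundary
conditions: the sites to the left of `m` (from which particles enter) count as occupied, the sites
to the right of `n` (to which particles leave) count as vacant. -/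
noncomputable def Config.state {m n : ℤ} (η : Config m n) (k : ℤ) : Bool :=
  if h : k ∈ Finset.Icc m n then η ⟨k, h⟩ else decide (k < m)

/-- The configuration obtained from `η` by setting the site `k` to `b`. -/
noncomputable def Config.set {m n : ℤ} (η : Config m n) (k : ℤ) (b : Bool) : Config m n :=
  fun i => if (i : ℤ) = k then b else η i

/-- The configuration `η_{k,k+1}` obtained from `η` by interchanging the values at the sites `k`
and `k + 1`; it is used for `m ≤ k < n` only. -/
noncomputable def Config.exchange {m n : ℤ} (η : Config m n) (k : ℤ) : Config m n :=
  fun i => η.state (Equiv.swap k (k + 1) (i : ℤ))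

/-- The generator of the exclusion process on `[m, n]` with boundary conditions. For `m ≤ k < n` a
particle at `k` jumps to `k + 1`, if that site is vacant, at rate `p k`, and a particle at `k + 1`
jumps to `k`, if that site is vacant, at rate `q (k + 1) = 1 - p (k + 1)`. If the site `m` is vacant,
a particle enters there at rate `p (m - 1)`; if the site `n` is occupied, its particle leaves the
interval at rate `p n`. -/
noncomputable def generator (m n : ℤ) (p : ℤ → ℝ) (f : Config m n → ℝ) (η : Config m n) : ℝ :=
  (∑ k ∈ Finset.Ico m n,
    ((if η.state k = true ∧ η.state (k + 1) = false then p k else 0) +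
      (if η.state k = false ∧ η.state (k + 1) = true then 1 - p (k + 1) else 0)) *
        (f (η.exchange k) - f η)) +
  (if η.state m = false then p (m - 1) else 0) * (f (η.set m true) - f η) +
  (if η.state n = true then p n else 0) * (f (η.set n false) - f η)

/-- `μ` (given by its point masses) is a stationary distribution of the exclusion process on
`[m, n]`: it is a probability distribution, and `∫ L f dμ = 0` for every function `f` on the finite
state space, `L` being the generator. -/
def IsStationary (m n : ℤ) (p : ℤ → ℝ) (μ : Config m n → ℝ) : Prop :=
  μ ∈ stdSimplex ℝ (Config m n) ∧
    ∀ f : Config m n → ℝ, ∑ η, μ η * generator m n p f η = 0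

/-- The probability of an event `A` under the distribution with point masses `μ`. -/
noncomputable def prob {m n : ℤ} (μ : Config m n → ℝ) (A : Config m n → Prop) [DecidablePred A] : ℝ :=
  ∑ η with A η, μ η

/-- The flux of `μ` across the bond from `k` to `k + 1`,
`p k * μ {η(k) = 1, η(k+1) = 0} - q (k+1) * μ {η(k) = 0, η(k+1) = 1}`. By the convention in
`Config.state`, for `k = m - 1` this is the rate `p (m - 1) * μ {η(m) = 0}` at which particles enter,
and for `k = n` it is the rate `p n * μ {η(n) = 1}` at which particles leave. -/
noncomputable def flux {m n : ℤ} (p : ℤ → ℝ) (μ : Config m n → ℝ) (k : ℤ) : ℝ :=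
  p k * prob μ (fun η => η.state k = true ∧ η.state (k + 1) = false) -
    (1 - p (k + 1)) * prob μ (fun η => η.state k = false ∧ η.state (k + 1) = true)

end OpenExclusion

/-!
The flux is compared through height functions. Encode a configuration `η` on `[m, n]` by its height
function: the height at `j ∈ [m - 1, n]` is the number of particles to the right of `j`. With the sites
left of `m` counted as occupied and those right of `n` as vacant, every transition is an exchange
across a bond `(k, k + 1)` with `m - 1 ≤ k ≤ n` (`generator_eq_sum`), and it changes the height at `k`
by `±1`; at an exit the whole height function also drops by one. The height process leaves this drop
out, so that its growth counts the exits (`heightStep_height`).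

Monotonicity. The height at `k` goes up at rate `p k` or `0`, and down at rate `1 - p (k + 1)` or `0`.
If `h ≤ h'` and `h k = h' k`, then the gradients of `h` and `h'` are ordered in such a way that the
upward rate is at least as large for `h'`, and the downward rate at least as large for `h`; raising `p`
acts in the same direction. Where `h k < h' k`, one jump cannot destroy the order. Hence `h ≤ h'` is
preserved, in the form that a step of small length of the chain preserves the relation "`F h ≤ F' h'`
whenever `h ≤ h'`" between functions (`heightStep_le`). Under a stationary distribution the expected
height at `n` grows by exactly the flux per unit of time (`IsStationary.sum_heightIter`), while the
choice of the initial configuration matters only by a bounded amount; dividing by the time gives the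
inequality of the fluxes (`flux_last_le`).

Conservation. The height at `k`, relative to that at `n`, is a function on the state space on which the
generator is the current across `k` minus the exit current; so stationarity says that the two fluxes
agree (`IsStationary.flux_eq`).

Existence and uniqueness. By the maximum principle, and since the empty configuration `∅` can be
reached from everywhere, the operator `f ↦ L f + f(∅)` is injective (`shiftedGenerator_injective`), hence
bijective on the finite-dimensional space of functions. The functional `g = L f + f(∅) ↦ f(∅)` is then the
one and only stationary distribution; it is positive since `L f ≤ 0` at a maximum of `f`.
-/

namespace OpenExclusion

variable {m n : ℤ}

/-! ### The generator as a sum over bonds -/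

/-- The rate at which the bond from `k` to `k + 1` is used in the configuration `η`. With the
convention of `Config.state` this covers the entrance (`k = m - 1`) and the exit (`k = n`). -/
noncomputable def jumpRate (p : ℤ → ℝ) (η : Config m n) (k : ℤ) : ℝ :=
  (if η.state k = true ∧ η.state (k + 1) = false then p k else 0) +
    (if η.state k = false ∧ η.state (k + 1) = true then 1 - p (k + 1) else 0)

lemma Config.state_of_lt (η : Config m n) {k : ℤ} (hk : k < m) : η.state k = true := by
  have : k ∉ Finset.Icc m n := by simp; omega
  simp [Config.state, this, hk]

lemma Config.state_of_gt (η : Config m n) (hmn : m ≤ n) {k : ℤ} (hk : n < k) :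
    η.state k = false := by
  have : k ∉ Finset.Icc m n := by simp; omega
  simp [Config.state, this]; omega

lemma Config.state_exchange (η : Config m n) (k : ℤ) {i : ℤ} (hi : i ∈ Finset.Icc m n) :
    (η.exchange k).state i = η.state (Equiv.swap k (k + 1) i) := by
  simp only [Config.state, Config.exchange, hi, dite_true]

lemma Config.exchange_pred (η : Config m n) : η.exchange (m - 1) = η.set m true := by
  funext i
  have hi := i.2
  simp only [Finset.mem_Icc] at hi
  unfold Config.exchange Config.set
  split_ifs with h
  · rw [h]
    have : Equiv.swap (m - 1) (m - 1 + 1) m = m - 1 := by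
      rw [sub_add_cancel]; exact Equiv.swap_apply_right _ _
    rw [this, η.state_of_lt (by omega)]
  · rw [Equiv.swap_apply_of_ne_of_ne (by omega) (by omega)]
    simp [Config.state, i.2]

lemma Config.exchange_last (η : Config m n) (hmn : m ≤ n) : η.exchange n = η.set n false := by
  funext i
  have hi := i.2
  simp only [Finset.mem_Icc] at hi
  unfold Config.exchange Config.set
  split_ifs with h
  · rw [h, Equiv.swap_apply_left, η.state_of_gt hmn (by omega)]
  · rw [Equiv.swap_apply_of_ne_of_ne (by omega) (by omega)]
    simp [Config.state, i.2]

lemma generator_eq_sum (hmn : m ≤ n) (p : ℤ → ℝ) (f : Config m n → ℝ) (η : Config m n) :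
    generator m n p f η =
      ∑ k ∈ Finset.Icc (m - 1) n, jumpRate p η k * (f (η.exchange k) - f η) := by
  have h : Finset.Icc (m - 1) n = insert n (insert (m - 1) (Finset.Ico m n)) := by
    ext; simp; omega
  rw [h, Finset.sum_insert (by simp; omega), Finset.sum_insert (by simp),
    Config.exchange_pred, Config.exchange_last η hmn]
  have h1 : jumpRate p η (m - 1) = if η.state m = false then p (m - 1) else 0 := by
    simp [jumpRate, η.state_of_lt (show m - 1 < m by omega)]
  have h2 : jumpRate p η n = if η.state n = true then p n else 0 := by
    simp [jumpRate, η.state_of_gt hmn (show n < n + 1 by omega)]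
  rw [h1, h2]
  unfold generator jumpRate
  ring

lemma jumpRate_nonneg (hmn : m ≤ n) {p : ℤ → ℝ}
    (hp : ∀ i ∈ Set.Icc (m - 1) n, p i ∈ Set.Ioo (0 : ℝ) 1) (η : Config m n) {k : ℤ}
    (hk : k ∈ Finset.Icc (m - 1) n) : 0 ≤ jumpRate p η k := by
  rw [Finset.mem_Icc] at hk
  unfold jumpRate
  refine add_nonneg ?_ ?_
  · split_ifs
    · exact (hp k hk).1.le
    · rfl
  · split_ifs with h
    · have : k + 1 ≤ n := by
        by_contra hc
        have := η.state_of_gt hmn (show n < k + 1 by omega)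
        simp_all
      linarith [(hp (k + 1) ⟨by omega, this⟩).2]
    · rfl

lemma flux_eq_sum (p : ℤ → ℝ) (μ : Config m n → ℝ) (k : ℤ) :
    flux p μ k = ∑ η, μ η *
      ((if η.state k = true ∧ η.state (k + 1) = false then p k else 0) -
        (if η.state k = false ∧ η.state (k + 1) = true then 1 - p (k + 1) else 0)) := by
  simp only [flux, prob, Finset.sum_filter, Finset.mul_sum, mul_ite, mul_zero,
    ← Finset.sum_sub_distrib]
  refine Finset.sum_congr rfl fun η _ => ?_
  split_ifs <;> ring

/-! ### Height functions -/

/-- The indicator function of `[m - 1, n]`, as a height function. -/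
noncomputable def plateau (m n : ℤ) : ℤ → ℤ := fun j => if m - 1 ≤ j ∧ j ≤ n then 1 else 0

/-- The height function of `η`: for `j` in `[m - 1, n]`, the number of particles to the right
of `j`. It is set to zero outside `[m - 1, n]`. -/
noncomputable def height (η : Config m n) : ℤ → ℤ := fun j =>
  if j < m - 1 then 0 else ∑ i ∈ Finset.Icc (j + 1) n, if η.state i = true then 1 else 0

lemma height_of_lt (η : Config m n) {j : ℤ} (hj : j < m - 1) : height η j = 0 := by
  simp [height, hj]

lemma height_of_ge (η : Config m n) {j : ℤ} (hj : n ≤ j) : height η j = 0 := by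
  simp only [height]
  rw [Finset.Icc_eq_empty (by omega)]
  simp

lemma height_pred (η : Config m n) {j : ℤ} (hj : m ≤ j) (hjn : j ≤ n) :
    height η (j - 1) = height η j + if η.state j = true then 1 else 0 := by
  have h : Finset.Icc (j - 1 + 1) n = insert j (Finset.Icc (j + 1) n) := by ext; simp; omega
  unfold height
  rw [if_neg (by omega), if_neg (by omega), h, Finset.sum_insert (by simp), add_comm]

lemma height_nonneg (η : Config m n) (j : ℤ) : 0 ≤ height η j := by
  unfold height
  split_ifs
  · rfl
  · exact Finset.sum_nonneg fun i _ => by split_ifs <;> simp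

lemma height_le (hmn : m ≤ n) (η : Config m n) (j : ℤ) : height η j ≤ n - m + 1 := by
  unfold height
  split_ifs
  · omega
  · calc _ ≤ ∑ i ∈ Finset.Icc (j + 1) n, (1 : ℤ) :=
        Finset.sum_le_sum fun i _ => by split_ifs <;> simp
      _ ≤ n - m + 1 := by simp; omega

/-- The height function is determined by its discrete gradient, which is the configuration, and
by its boundary values. -/
lemma eq_height (η : Config m n) {g : ℤ → ℤ} (hlt : ∀ j < m - 1, g j = 0)
    (hge : ∀ j, n ≤ j → g j = 0)
    (hg : ∀ j, m ≤ j → j ≤ n → g (j - 1) = g j + if η.state j = true then 1 else 0) :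
    g = height η := by
  have key : ∀ d : ℕ, m - 1 ≤ n - d → g (n - d) = height η (n - d) := by
    intro d
    induction d with
    | zero => intro _; rw [hge _ (by simp), height_of_ge _ (by simp)]
    | succ d ih =>
      intro hd
      push_cast at hd ⊢
      have e : n - ((d : ℤ) + 1) = n - d - 1 := by ring
      rw [e, hg _ (by omega) (by omega), height_pred _ (by omega) (by omega), ih (by omega)]
  funext j
  rcases lt_or_ge j (m - 1) with h | h
  · rw [hlt j h, height_of_lt _ h]
  rcases le_or_gt n j with h' | h'
  · rw [hge j h', height_of_ge _ h']
  · have := key (n - j).toNat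
    rw [Int.toNat_of_nonneg (by omega), sub_sub_cancel] at this
    exact this h

/-- A jump to the right across `k` raises the height at `k` by one, up to the normalization at `n`:
an exit also lowers the whole height function by one. -/
lemma height_exchange_right (hmn : m ≤ n) (η : Config m n) {k : ℤ} (hk : m - 1 ≤ k) (hkn : k ≤ n)
    (h1 : η.state k = true) (h0 : η.state (k + 1) = false) :
    height (η.exchange k) = height η + Pi.single k 1 - if k = n then plateau m n else 0 := by
  symm
  apply eq_height
  · intro j hj
    rw [Pi.sub_apply, Pi.add_apply, height_of_lt _ hj, Pi.single_eq_of_ne (by omega)]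
    split_ifs
    · simp [plateau]; omega
    · simp
  · intro j hj
    rw [Pi.sub_apply, Pi.add_apply, height_of_ge _ hj]
    by_cases hkj : k = j
    · subst hkj
      obtain rfl : k = n := by omega
      simp [plateau]; omega
    · rw [Pi.single_eq_of_ne (by omega)]
      split_ifs
      · simp [plateau]; omega
      · simp
  · intro j hj hjn
    have hs : (if k = n then plateau m n else 0) (j - 1) =
        (if k = n then plateau m n else 0) j := by
      split_ifs
      · simp only [plateau]
        rw [if_pos (by omega), if_pos (by omega)]
      · rfl
    rw [Pi.sub_apply, Pi.add_apply, Pi.sub_apply, Pi.add_apply, hs, height_pred η hj hjn,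
      η.state_exchange k (by simp; omega)]
    rcases eq_or_ne j k with rfl | h
    · rw [Equiv.swap_apply_left, h0, h1, Pi.single_eq_of_ne (by omega)]
      simp
    · rcases eq_or_ne j (k + 1) with rfl | h'
      · rw [Equiv.swap_apply_right, h0, h1, Pi.single_eq_of_ne h]
        simp; ring
      · rw [Equiv.swap_apply_of_ne_of_ne h h', Pi.single_eq_of_ne (by omega),
          Pi.single_eq_of_ne h]
        ring

/-- A jump to the left across `k` lowers the height at `k` by one. -/
lemma height_exchange_left (hmn : m ≤ n) (η : Config m n) {k : ℤ}
    (h0 : η.state k = false) (h1 : η.state (k + 1) = true) :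
    height (η.exchange k) = height η - Pi.single k 1 := by
  have hk : m ≤ k := by
    by_contra hc
    simp [η.state_of_lt (show k < m by omega)] at h0
  have hkn : k < n := by
    by_contra hc
    simp [η.state_of_gt hmn (show n < k + 1 by omega)] at h1
  symm
  apply eq_height
  · intro j hj
    rw [Pi.sub_apply, height_of_lt _ hj, Pi.single_eq_of_ne (by omega), sub_zero]
  · intro j hj
    rw [Pi.sub_apply, height_of_ge _ hj, Pi.single_eq_of_ne (by omega), sub_zero]
  · intro j hj hjn
    rw [Pi.sub_apply, Pi.sub_apply, height_pred η hj hjn, η.state_exchange k (by simp; omega)]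
    rcases eq_or_ne j k with rfl | h
    · rw [Equiv.swap_apply_left, h0, h1, Pi.single_eq_of_ne (by omega)]
      simp
    · rcases eq_or_ne j (k + 1) with rfl | h'
      · rw [Equiv.swap_apply_right, h0, h1, Pi.single_eq_of_ne h]
        simp
      · rw [Equiv.swap_apply_of_ne_of_ne h h', Pi.single_eq_of_ne (by omega),
          Pi.single_eq_of_ne h]
        ring

/-! ### Comparison of height processes -/

/-- The rate at which the height `h` goes up at `k`. It is defined for arbitrary `h : ℤ → ℤ`, in such
a way that it is monotone in the heights at the neighbours of `k`. -/
noncomputable def upRate (m n : ℤ) (p : ℤ → ℝ) (h : ℤ → ℤ) (k : ℤ) : ℝ :=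
  if (k = m - 1 ∨ h k < h (k - 1)) ∧ (k = n ∨ h k ≤ h (k + 1)) then p k else 0

/-- The rate at which the height `h` goes down at `k`, for arbitrary `h : ℤ → ℤ`. It is antitone in
the heights at the neighbours of `k`. -/
noncomputable def downRate (m n : ℤ) (p : ℤ → ℝ) (h : ℤ → ℤ) (k : ℤ) : ℝ :=
  if (k ≠ m - 1 ∧ h (k - 1) ≤ h k) ∧ (k ≠ n ∧ h (k + 1) < h k) then 1 - p (k + 1) else 0

/-- One step, of length `ε`, of the discrete time chain of heights, acting on functions. -/
noncomputable def heightStep (m n : ℤ) (p : ℤ → ℝ) (ε : ℝ) (F : (ℤ → ℤ) → ℝ) (h : ℤ → ℤ) : ℝ :=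
  F h + ε * ∑ k ∈ Finset.Icc (m - 1) n,
    (upRate m n p h k * (F (h + Pi.single k 1) - F h) +
      downRate m n p h k * (F (h - Pi.single k 1) - F h))

lemma upRate_mem {p : ℤ → ℝ} (hp : ∀ i ∈ Set.Icc (m - 1) n, p i ∈ Set.Ioo (0 : ℝ) 1) (h : ℤ → ℤ)
    {k : ℤ} (hk : k ∈ Finset.Icc (m - 1) n) : upRate m n p h k ∈ Set.Icc (0 : ℝ) 1 := by
  rw [Finset.mem_Icc] at hk
  unfold upRate
  split_ifs
  · exact ⟨(hp k hk).1.le, (hp k hk).2.le⟩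
  · simp

lemma downRate_mem {p : ℤ → ℝ} (hp : ∀ i ∈ Set.Icc (m - 1) n, p i ∈ Set.Ioo (0 : ℝ) 1)
    (h : ℤ → ℤ) {k : ℤ} (hk : k ∈ Finset.Icc (m - 1) n) :
    downRate m n p h k ∈ Set.Icc (0 : ℝ) 1 := by
  rw [Finset.mem_Icc] at hk
  unfold downRate
  split_ifs with hc
  · have := hp (k + 1) ⟨by omega, by omega⟩
    exact ⟨by linarith [this.2], by linarith [this.1]⟩
  · simp

lemma upRate_le {p p' : ℤ → ℝ} (hp' : ∀ i ∈ Set.Icc (m - 1) n, p' i ∈ Set.Ioo (0 : ℝ) 1)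
    (hle : ∀ i ∈ Set.Icc (m - 1) n, p i ≤ p' i) {h h' : ℤ → ℤ} (hh : h ≤ h') {k : ℤ}
    (hk : k ∈ Finset.Icc (m - 1) n) (heq : h k = h' k) : upRate m n p h k ≤ upRate m n p' h' k := by
  have h1 : h (k - 1) ≤ h' (k - 1) := hh (k - 1)
  have h2 : h (k + 1) ≤ h' (k + 1) := hh (k + 1)
  rw [Finset.mem_Icc] at hk
  unfold upRate
  by_cases hc : (k = m - 1 ∨ h k < h (k - 1)) ∧ (k = n ∨ h k ≤ h (k + 1))
  · rw [if_pos hc, if_pos (by omega)]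
    exact hle k hk
  · rw [if_neg hc]
    split_ifs
    · exact (hp' k hk).1.le
    · rfl

lemma downRate_le {p p' : ℤ → ℝ} (hp : ∀ i ∈ Set.Icc (m - 1) n, p i ∈ Set.Ioo (0 : ℝ) 1)
    (hle : ∀ i ∈ Set.Icc (m - 1) n, p i ≤ p' i) {h h' : ℤ → ℤ} (hh : h ≤ h') {k : ℤ}
    (hk : k ∈ Finset.Icc (m - 1) n) (heq : h k = h' k) :
    downRate m n p' h' k ≤ downRate m n p h k := by
  have h1 : h (k - 1) ≤ h' (k - 1) := hh (k - 1)
  have h2 : h (k + 1) ≤ h' (k + 1) := hh (k + 1)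
  have h0 := (downRate_mem hp h hk).1
  rw [Finset.mem_Icc] at hk
  by_cases hc : (k ≠ m - 1 ∧ h' (k - 1) ≤ h' k) ∧ (k ≠ n ∧ h' (k + 1) < h' k)
  · unfold downRate
    rw [if_pos hc, if_pos (by omega)]
    linarith [hle (k + 1) ⟨by omega, by omega⟩]
  · unfold downRate at h0 ⊢
    rwa [if_neg hc]

/-- If `x ≤ y` are the current values, and jumps lead from `x` to `a` at rate `r` and from `y` to `b` at
rate `s`, then, under each of the three order relations that occur between heights, the two jumps
together change the difference `y - x` at rate at least `-2 (y - x)`. -/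
lemma jump_bound {x y a b r s : ℝ} (hxy : x ≤ y) (hr : r ∈ Set.Icc (0 : ℝ) 1)
    (hs : s ∈ Set.Icc (0 : ℝ) 1) (h : a ≤ y ∧ x ≤ b ∨ r ≤ s ∧ a ≤ b ∧ x ≤ b ∨
      s ≤ r ∧ a ≤ b ∧ a ≤ y) :
    -(2 * (y - x)) ≤ s * (b - y) - r * (a - x) := by
  obtain ⟨hr0, hr1⟩ := hr
  obtain ⟨hs0, hs1⟩ := hs
  rcases h with ⟨h1, h2⟩ | ⟨h1, h2, h3⟩ | ⟨h1, h2, h3⟩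
  · nlinarith [mul_nonneg hs0 (sub_nonneg.2 h2), mul_nonneg hr0 (sub_nonneg.2 h1),
      mul_nonneg (sub_nonneg.2 hs1) (sub_nonneg.2 hxy),
      mul_nonneg (sub_nonneg.2 hr1) (sub_nonneg.2 hxy)]
  · nlinarith [mul_nonneg (sub_nonneg.2 h1) (sub_nonneg.2 h3), mul_nonneg hr0 (sub_nonneg.2 h2),
      mul_nonneg (sub_nonneg.2 hs1) (sub_nonneg.2 hxy)]
  · nlinarith [mul_nonneg (sub_nonneg.2 h1) (sub_nonneg.2 h3), mul_nonneg hs0 (sub_nonneg.2 h2),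
      mul_nonneg (sub_nonneg.2 hr1) (sub_nonneg.2 hxy)]

/-- The comparison of the two height processes: the relation "`F h ≤ F' h'` whenever `h ≤ h'`" is
preserved by a step. Where `h` and `h'` differ, a single jump does not destroy `h ≤ h'`; where they
agree, the rates are ordered the right way. -/
lemma heightStep_le {p p' : ℤ → ℝ} (hp : ∀ i ∈ Set.Icc (m - 1) n, p i ∈ Set.Ioo (0 : ℝ) 1)
    (hp' : ∀ i ∈ Set.Icc (m - 1) n, p' i ∈ Set.Ioo (0 : ℝ) 1)
    (hle : ∀ i ∈ Set.Icc (m - 1) n, p i ≤ p' i) {ε : ℝ} (hε : 0 ≤ ε)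
    (hε1 : 4 * (Finset.Icc (m - 1) n).card * ε ≤ 1) {F F' : (ℤ → ℤ) → ℝ}
    (hF : ∀ h h', h ≤ h' → F h ≤ F' h') {h h' : ℤ → ℤ} (hh : h ≤ h') :
    heightStep m n p ε F h ≤ heightStep m n p' ε F' h' := by
  have hd := hF h h' hh
  have key : ∀ k ∈ Finset.Icc (m - 1) n, -(4 * (F' h' - F h)) ≤
      (upRate m n p' h' k * (F' (h' + Pi.single k 1) - F' h') +
        downRate m n p' h' k * (F' (h' - Pi.single k 1) - F' h')) -
      (upRate m n p h k * (F (h + Pi.single k 1) - F h) +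
        downRate m n p h k * (F (h - Pi.single k 1) - F h)) := by
    intro k hk
    have ab : F (h + Pi.single k 1) ≤ F' (h' + Pi.single k 1) := hF _ _ (by gcongr)
    have ab' : F (h - Pi.single k 1) ≤ F' (h' - Pi.single k 1) := hF _ _ (by gcongr)
    have b1 : F h ≤ F' (h' + Pi.single k 1) := hF _ _ (hh.trans (by simp))
    have a1 : F (h - Pi.single k 1) ≤ F' h' := hF _ _ (le_trans (by simp) hh)
    have hu := upRate_mem hp h hk
    have hu' := upRate_mem hp' h' hk
    have hv := downRate_mem hp h hk
    have hv' := downRate_mem hp' h' hk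
    have up : -(2 * (F' h' - F h)) ≤ upRate m n p' h' k * (F' (h' + Pi.single k 1) - F' h') -
        upRate m n p h k * (F (h + Pi.single k 1) - F h) := by
      apply jump_bound hd hu hu'
      rcases (hh k).lt_or_eq with hlt | heq
      · refine Or.inl ⟨hF _ _ fun j => ?_, b1⟩
        have := hh j
        by_cases hj : j = k
        · subst hj; simp; omega
        · simpa [hj] using this
      · exact Or.inr (Or.inl ⟨upRate_le hp' hle hh hk heq, ab, b1⟩)
    have down : -(2 * (F' h' - F h)) ≤
        downRate m n p' h' k * (F' (h' - Pi.single k 1) - F' h') -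
        downRate m n p h k * (F (h - Pi.single k 1) - F h) := by
      apply jump_bound hd hv hv'
      rcases (hh k).lt_or_eq with hlt | heq
      · refine Or.inl ⟨a1, hF _ _ fun j => ?_⟩
        have := hh j
        by_cases hj : j = k
        · subst hj; simp; omega
        · simpa [hj] using this
      · exact Or.inr (Or.inr ⟨downRate_le hp hle hh hk heq, ab', a1⟩)
    linarith
  have hsum := Finset.sum_le_sum key
  rw [Finset.sum_const, nsmul_eq_mul, Finset.sum_sub_distrib] at hsum
  have := mul_le_mul_of_nonneg_left hsum hε
  unfold heightStep
  nlinarith [mul_nonneg (sub_nonneg.2 hd) (sub_nonneg.2 hε1)]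

/-- The rates depend on differences of heights in `[m - 1, n]` only. -/
lemma heightStep_add_plateau {p : ℤ → ℝ} {ε : ℝ} {F : (ℤ → ℤ) → ℝ}
    (hF : ∀ h, F (h + plateau m n) = F h + 1) (h : ℤ → ℤ) :
    heightStep m n p ε F (h + plateau m n) = heightStep m n p ε F h + 1 := by
  unfold heightStep
  rw [hF, add_right_comm]
  congr 2
  congr 1
  refine Finset.sum_congr rfl fun k hk => ?_
  rw [Finset.mem_Icc] at hk
  have pl : ∀ j, m - 1 ≤ j → j ≤ n → plateau m n j = 1 := fun j h1 h2 => by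
    simp only [plateau]; rw [if_pos ⟨h1, h2⟩]
  have hl : k = m - 1 ∨ plateau m n (k - 1) = 1 := by
    by_cases hk' : k = m - 1
    · exact Or.inl hk'
    · exact Or.inr (pl _ (by omega) (by omega))
  have hr : k = n ∨ plateau m n (k + 1) = 1 := by
    by_cases hk' : k = n
    · exact Or.inl hk'
    · exact Or.inr (pl _ (by omega) (by omega))
  have hm := pl k hk.1 hk.2
  have hu : upRate m n p (h + plateau m n) k = upRate m n p h k := by
    unfold upRate
    simp only [Pi.add_apply]
    congr 1
    exact propext (by omega)
  have hv : downRate m n p (h + plateau m n) k = downRate m n p h k := by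
    unfold downRate
    simp only [Pi.add_apply]
    congr 1
    exact propext (by omega)
  rw [hu, hv, add_right_comm, hF, ← sub_add_eq_add_sub h, hF]
  ring

lemma sub_plateau {F : (ℤ → ℤ) → ℝ} (hF : ∀ h, F (h + plateau m n) = F h + 1) (h : ℤ → ℤ) :
    F (h - plateau m n) = F h - 1 := by
  have := hF (h - plateau m n)
  rw [sub_add_cancel] at this
  linarith

lemma upRate_height (hmn : m ≤ n) (p : ℤ → ℝ) (η : Config m n) {k : ℤ} (hk : m - 1 ≤ k)
    (hkn : k ≤ n) : upRate m n p (height η) k =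
      if η.state k = true ∧ η.state (k + 1) = false then p k else 0 := by
  unfold upRate
  congr 1
  refine propext (and_congr ?_ ?_)
  · rcases hk.eq_or_lt with rfl | h
    · simp [η.state_of_lt (show m - 1 < m by omega)]
    · rw [height_pred η (by omega) hkn]
      cases η.state k <;> simp; omega
  · rcases hkn.eq_or_lt with rfl | h
    · simp [η.state_of_gt hmn (show k < k + 1 by omega)]
    · have := height_pred η (j := k + 1) (by omega) (by omega)
      rw [add_sub_cancel_right] at this
      rw [this]
      cases η.state (k + 1) <;> simp; omega

lemma downRate_height (hmn : m ≤ n) (p : ℤ → ℝ) (η : Config m n) {k : ℤ} (hk : m - 1 ≤ k)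
    (hkn : k ≤ n) : downRate m n p (height η) k =
      if η.state k = false ∧ η.state (k + 1) = true then 1 - p (k + 1) else 0 := by
  unfold downRate
  congr 1
  refine propext (and_congr ?_ ?_)
  · rcases hk.eq_or_lt with rfl | h
    · simp [η.state_of_lt (show m - 1 < m by omega)]
    · rw [height_pred η (by omega) hkn]
      cases η.state k <;> simp; omega
  · rcases hkn.eq_or_lt with rfl | h
    · simp [η.state_of_gt hmn (show k < k + 1 by omega)]
    · have := height_pred η (j := k + 1) (by omega) (by omega)
      rw [add_sub_cancel_right] at this
      rw [this]
      cases η.state (k + 1) <;> simp; omega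

/-- On the height functions of configurations, the height process follows the exclusion process;
the additional term counts the particles that leave. -/
lemma heightStep_height (hmn : m ≤ n) (p : ℤ → ℝ) (ε : ℝ) {F : (ℤ → ℤ) → ℝ}
    (hF : ∀ h, F (h + plateau m n) = F h + 1) (η : Config m n) :
    heightStep m n p ε F (height η) = F (height η) +
      ε * (generator m n p (fun ζ => F (height ζ)) η + if η.state n = true then p n else 0) := by
  unfold heightStep
  rw [generator_eq_sum hmn]
  have h0 : (if η.state n = true then p n else 0) = ∑ k ∈ Finset.Icc (m - 1) n,
      if k = n then (if η.state n = true then p n else 0) else 0 := by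
    rw [Finset.sum_ite_eq', if_pos (Finset.mem_Icc.2 (by omega))]
  rw [h0, ← Finset.sum_add_distrib]
  congr 2
  refine Finset.sum_congr rfl fun k hk => ?_
  rw [Finset.mem_Icc] at hk
  rw [upRate_height hmn p η hk.1 hk.2, downRate_height hmn p η hk.1 hk.2, jumpRate]
  by_cases h1 : η.state k = true ∧ η.state (k + 1) = false
  · rw [height_exchange_right hmn η hk.1 hk.2 h1.1 h1.2]
    by_cases hkn : k = n
    · subst hkn
      simp only [h1, if_true, sub_plateau hF]
      simp
      ring
    · simp [h1, hkn]
  · by_cases h2 : η.state k = false ∧ η.state (k + 1) = true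
    · have hkn : k ≠ n := by
        rintro rfl
        simp [η.state_of_gt hmn (show k < k + 1 by omega)] at h2
      rw [height_exchange_left hmn η h2.1 h2.2]
      simp [h2, hkn]
    · have hkn : k = n → η.state n = false := by
        rintro rfl
        simpa [η.state_of_gt hmn (show k < k + 1 by omega)] using h1
      rw [if_neg h1, if_neg h2]
      by_cases hk' : k = n
      · simp [hkn hk']
      · simp [hk']

/-! ### The flux of a stationary distribution -/

lemma flux_last (hmn : m ≤ n) (p : ℤ → ℝ) (μ : Config m n → ℝ) :
    flux p μ n = ∑ η, μ η * if η.state n = true then p n else 0 := by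
  rw [flux_eq_sum]
  refine Finset.sum_congr rfl fun η _ => ?_
  simp [η.state_of_gt hmn (show n < n + 1 by omega)]

/-- The height at `k` grows with the current across `k`, and decreases with the exits. So the
stationarity of its expectation says that the flux is the same across `k` and across `n`. -/
lemma IsStationary.flux_eq (hmn : m ≤ n) {p : ℤ → ℝ} {μ : Config m n → ℝ}
    (hμ : IsStationary m n p μ) {k : ℤ} (hk : m - 1 ≤ k) (hkn : k ≤ n) :
    flux p μ k = flux p μ n := by
  have hF : ∀ h : ℤ → ℤ, ((((h + plateau m n) k : ℤ)) : ℝ) = (h k : ℝ) + 1 := by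
    intro h
    simp [plateau]; omega
  have h := hμ.2 (fun ζ => (height ζ k : ℝ))
  rw [flux_last hmn, flux_eq_sum, ← sub_eq_zero, ← Finset.sum_sub_distrib]
  refine Eq.trans ?_ h
  refine Finset.sum_congr rfl fun η _ => ?_
  have hs := heightStep_height hmn p 1 (F := fun h => (h k : ℝ)) hF η
  rw [heightStep, Finset.sum_eq_single k, upRate_height hmn p η hk hkn,
    downRate_height hmn p η hk hkn] at hs
  · simp only [Pi.add_apply, Pi.sub_apply, Pi.single_eq_same] at hs
    push_cast at hs
    rw [← mul_sub]
    congr 1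
    linarith
  · intro j _ hj
    simp [Pi.single_eq_of_ne hj.symm]
  · intro hc
    exact absurd (Finset.mem_Icc.2 ⟨hk, hkn⟩) hc

/-- The expectation of the height at `n` after `t` steps of the height process. -/
noncomputable def heightIter (m n : ℤ) (p : ℤ → ℝ) (ε : ℝ) (t : ℕ) : (ℤ → ℤ) → ℝ :=
  (heightStep m n p ε)^[t] fun h => (h n : ℝ)

lemma heightIter_succ (p : ℤ → ℝ) (ε : ℝ) (t : ℕ) :
    heightIter m n p ε (t + 1) = heightStep m n p ε (heightIter m n p ε t) :=
  Function.iterate_succ_apply' _ _ _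

lemma heightIter_add_plateau (hmn : m ≤ n) (p : ℤ → ℝ) (ε : ℝ) (t : ℕ) (h : ℤ → ℤ) :
    heightIter m n p ε t (h + plateau m n) = heightIter m n p ε t h + 1 := by
  induction t generalizing h with
  | zero => simp [heightIter, plateau]; omega
  | succ t ih => rw [heightIter_succ, heightStep_add_plateau ih]

/-- The flux is the mean growth of the height per unit of time. -/
lemma IsStationary.sum_heightIter (hmn : m ≤ n) {p : ℤ → ℝ} {μ : Config m n → ℝ}
    (hμ : IsStationary m n p μ) (ε : ℝ) (t : ℕ) :
    ∑ η, μ η * heightIter m n p ε t (height η) = t * (ε * flux p μ n) := by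
  induction t with
  | zero => simp [heightIter, height_of_ge]
  | succ t ih =>
    simp only [heightIter_succ, heightStep_height hmn p ε (heightIter_add_plateau hmn p ε t),
      mul_add, Finset.sum_add_distrib, mul_left_comm _ ε]
    rw [ih, ← Finset.mul_sum, ← Finset.mul_sum, hμ.2, ← flux_last hmn]
    push_cast
    ring

lemma heightIter_le {p p' : ℤ → ℝ} (hp : ∀ i ∈ Set.Icc (m - 1) n, p i ∈ Set.Ioo (0 : ℝ) 1)
    (hp' : ∀ i ∈ Set.Icc (m - 1) n, p' i ∈ Set.Ioo (0 : ℝ) 1)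
    (hle : ∀ i ∈ Set.Icc (m - 1) n, p i ≤ p' i) {ε : ℝ} (hε : 0 ≤ ε)
    (hε1 : 4 * (Finset.Icc (m - 1) n).card * ε ≤ 1) (t : ℕ) {h h' : ℤ → ℤ} (hh : h ≤ h') :
    heightIter m n p ε t h ≤ heightIter m n p' ε t h' := by
  induction t generalizing h h' with
  | zero => simpa [heightIter] using hh n
  | succ t ih =>
    rw [heightIter_succ, heightIter_succ]
    exact heightStep_le hp hp' hle hε hε1 (fun _ _ => ih) hh

/-- Any two height functions of configurations differ by a bounded amount, so the comparison of the
height processes costs a constant that does not depend on the time `t`. -/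
lemma heightIter_height_le (hmn : m ≤ n) {p p' : ℤ → ℝ}
    (hp : ∀ i ∈ Set.Icc (m - 1) n, p i ∈ Set.Ioo (0 : ℝ) 1)
    (hp' : ∀ i ∈ Set.Icc (m - 1) n, p' i ∈ Set.Ioo (0 : ℝ) 1)
    (hle : ∀ i ∈ Set.Icc (m - 1) n, p i ≤ p' i) {ε : ℝ} (hε : 0 ≤ ε)
    (hε1 : 4 * (Finset.Icc (m - 1) n).card * ε ≤ 1) (t : ℕ) (η ζ : Config m n) :
    heightIter m n p ε t (height η) ≤
      heightIter m n p' ε t (height ζ) + (n - m + 1).toNat := by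
  have shift : ∀ c : ℕ, heightIter m n p' ε t (height ζ + c • plateau m n) =
      heightIter m n p' ε t (height ζ) + c := by
    intro c
    induction c with
    | zero => simp
    | succ c ih =>
      rw [succ_nsmul, ← add_assoc, heightIter_add_plateau hmn, ih]
      push_cast
      ring
  rw [← shift]
  refine heightIter_le hp hp' hle hε hε1 t fun j => ?_
  rcases lt_or_ge j (m - 1) with h | h
  · simp [height_of_lt _ h, plateau]; omega
  rcases lt_or_ge n j with h' | h'
  · simp [height_of_ge _ h'.le, plateau]; omega
  have h1 := height_le hmn η j
  have h2 := height_nonneg ζ j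
  have h3 : plateau m n j = 1 := by simp only [plateau]; rw [if_pos ⟨h, h'⟩]
  simp only [Pi.add_apply, Pi.smul_apply, h3]
  simp
  omega

/-- Monotonicity of the flux at the exit: compare the growth of the two heights over long times. -/
lemma flux_last_le (hmn : m ≤ n) {p p' : ℤ → ℝ}
    (hp : ∀ i ∈ Set.Icc (m - 1) n, p i ∈ Set.Ioo (0 : ℝ) 1)
    (hp' : ∀ i ∈ Set.Icc (m - 1) n, p' i ∈ Set.Ioo (0 : ℝ) 1)
    (hle : ∀ i ∈ Set.Icc (m - 1) n, p i ≤ p' i) {μ μ' : Config m n → ℝ}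
    (hμ : IsStationary m n p μ) (hμ' : IsStationary m n p' μ') :
    flux p μ n ≤ flux p' μ' n := by
  have hN : 0 < ((Finset.Icc (m - 1) n).card : ℝ) := by
    rw [Nat.cast_pos, Finset.card_pos, Finset.nonempty_Icc]; omega
  obtain ⟨ε, hε, hε1⟩ : ∃ ε : ℝ, 0 < ε ∧ 4 * (Finset.Icc (m - 1) n).card * ε ≤ 1 :=
    ⟨(4 * (Finset.Icc (m - 1) n).card)⁻¹, by positivity, (mul_inv_cancel₀ (by positivity)).le⟩
  set C : ℝ := ((n - m + 1).toNat : ℝ)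
  have key : ∀ t : ℕ, t * (ε * flux p μ n) ≤ t * (ε * flux p' μ' n) + C := by
    intro t
    rw [← hμ.sum_heightIter hmn ε t, ← hμ'.sum_heightIter hmn ε t]
    have h1 : ∀ ζ : Config m n, ∑ η, μ η * heightIter m n p ε t (height η) ≤
        heightIter m n p' ε t (height ζ) + C := by
      intro ζ
      calc _ ≤ ∑ η, μ η * (heightIter m n p' ε t (height ζ) + C) :=
            Finset.sum_le_sum fun η _ => mul_le_mul_of_nonneg_left
              (heightIter_height_le hmn hp hp' hle hε.le hε1 t η ζ) (hμ.1.1 η)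
        _ = _ := by rw [← Finset.sum_mul, hμ.1.2, one_mul]
    calc _ = ∑ ζ : Config m n, μ' ζ * ∑ η : Config m n, μ η * heightIter m n p ε t (height η) := by
          rw [← Finset.sum_mul, hμ'.1.2, one_mul]
      _ ≤ ∑ ζ, μ' ζ * (heightIter m n p' ε t (height ζ) + C) :=
          Finset.sum_le_sum fun ζ _ => mul_le_mul_of_nonneg_left (h1 ζ) (hμ'.1.1 ζ)
      _ = _ := by simp only [mul_add, Finset.sum_add_distrib]; rw [← Finset.sum_mul, hμ'.1.2, one_mul]
  by_contra! hlt
  obtain ⟨t, ht⟩ := exists_nat_gt (C / (ε * (flux p μ n - flux p' μ' n)))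
  rw [div_lt_iff₀ (mul_pos hε (sub_pos.2 hlt))] at ht
  linarith [key t]

/-! ### Existence and uniqueness of the stationary distribution -/

lemma generator_nonpos_of_max (hmn : m ≤ n) {p : ℤ → ℝ}
    (hp : ∀ i ∈ Set.Icc (m - 1) n, p i ∈ Set.Ioo (0 : ℝ) 1) {f : Config m n → ℝ} {η : Config m n}
    (hη : ∀ ζ, f ζ ≤ f η) : generator m n p f η ≤ 0 := by
  rw [generator_eq_sum hmn]
  exact Finset.sum_nonpos fun k hk => mul_nonpos_of_nonneg_of_nonpos
    (jumpRate_nonneg hmn hp η hk) (sub_nonpos.2 (hη _))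

/-- In a nonempty configuration the rightmost particle can jump to the right. -/
lemma exists_jump_right (hmn : m ≤ n) {η : Config m n} (hη : η ≠ fun _ => false) :
    ∃ k, m ≤ k ∧ k ≤ n ∧ η.state k = true ∧ η.state (k + 1) = false := by
  have hne : ((Finset.Icc m n).filter fun k => η.state k = true).Nonempty := by
    obtain ⟨i, hi⟩ := Function.ne_iff.1 hη
    refine ⟨i, Finset.mem_filter.2 ⟨i.2, ?_⟩⟩
    rw [Config.state, dif_pos i.2]
    simpa using hi
  obtain ⟨k, hk, hmax⟩ := Finset.exists_max_image _ id hne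
  simp only [Finset.mem_filter, Finset.mem_Icc, id] at hk hmax
  refine ⟨k, hk.1.1, hk.1.2, hk.2, ?_⟩
  by_contra hc
  rw [Bool.not_eq_false] at hc
  by_cases hkn : k + 1 ≤ n
  · have := hmax (k + 1) ⟨⟨by omega, hkn⟩, hc⟩
    omega
  · simp [η.state_of_gt hmn (show n < k + 1 by omega)] at hc

/-- The strong maximum principle: the empty configuration can be reached from every other one, by
jumps to the right and exits, so a subharmonic function takes its maximum there. -/
lemma le_empty_of_generator_nonneg (hmn : m ≤ n) {p : ℤ → ℝ}
    (hp : ∀ i ∈ Set.Icc (m - 1) n, p i ∈ Set.Ioo (0 : ℝ) 1) {f : Config m n → ℝ}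
    (hf : ∀ η, 0 ≤ generator m n p f η) (ζ : Config m n) : f ζ ≤ f fun _ => false := by
  classical
  obtain ⟨η₀, hη₀⟩ := Finite.exists_max f
  -- Each jump to the right or exit lowers the sum of the distances of the particles from `n + 1`.
  obtain ⟨η, hη, hmin⟩ := Finset.exists_min_image
    (Finset.univ.filter fun η : Config m n => ∀ ζ, f ζ ≤ f η)
    (fun η => ∑ j ∈ Finset.Icc m n, (height η (m - 1) - height η j)) ⟨η₀, by simpa using hη₀⟩
  simp only [Finset.mem_filter, Finset.mem_univ, true_and] at hη hmin
  by_cases he : η = fun _ => false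
  · rw [← he]; exact hη ζ
  exfalso
  obtain ⟨k, hk, hkn, h1, h0⟩ := exists_jump_right hmn he
  have hkI : k ∈ Finset.Icc (m - 1) n := Finset.mem_Icc.2 ⟨by omega, hkn⟩
  have hfk : f (η.exchange k) = f η := by
    have hz := le_antisymm (generator_nonpos_of_max hmn hp hη) (hf η)
    rw [generator_eq_sum hmn, Finset.sum_eq_zero_iff_of_nonpos fun j hj =>
      mul_nonpos_of_nonneg_of_nonpos (jumpRate_nonneg hmn hp η hj) (sub_nonpos.2 (hη _))] at hz
    have hpk : jumpRate p η k = p k := by simp [jumpRate, h1, h0]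
    have hz := hz k hkI
    rw [hpk] at hz
    have := (hp k (Finset.mem_Icc.1 hkI)).1
    exact sub_eq_zero.1 ((mul_eq_zero.1 hz).resolve_left this.ne')
  have hm := hmin (η.exchange k) fun ζ => by rw [hfk]; exact hη ζ
  rw [height_exchange_right hmn η (by omega) hkn h1 h0] at hm
  refine absurd hm (not_le.2 (Finset.sum_lt_sum (fun j hj => ?_) ⟨k, by simp; omega, ?_⟩))
  · have hj := Finset.mem_Icc.1 hj
    have hpl : (if k = n then plateau m n else 0) (m - 1) =
        (if k = n then plateau m n else 0) j := by
      split_ifs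
      · simp only [plateau]
        rw [if_pos (by omega), if_pos (by omega)]
      · rfl
    have hs : (0 : ℤ) ≤ (Pi.single k 1 : ℤ → ℤ) j := by
      by_cases h : j = k
      · subst h; simp
      · simp [h]
    simp only [Pi.sub_apply, Pi.add_apply, hpl]
    rw [Pi.single_eq_of_ne (show m - 1 ≠ k by omega)]
    omega
  · have hpl : (if k = n then plateau m n else 0) (m - 1) =
        (if k = n then plateau m n else 0) k := by
      split_ifs
      · simp only [plateau]
        rw [if_pos (by omega), if_pos (by omega)]
      · rfl
    simp only [Pi.sub_apply, Pi.add_apply, hpl]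
    rw [Pi.single_eq_of_ne (show m - 1 ≠ k by omega), Pi.single_eq_same]
    omega

/-- The operator `f ↦ L f + f(∅)`, where `L` is the generator and `∅` the empty configuration. It is
invertible, and the stationary expectation of `g` is the value at `∅` of the preimage of `g`. -/
noncomputable def shiftedGenerator (hmn : m ≤ n) (p : ℤ → ℝ) :
    (Config m n → ℝ) →ₗ[ℝ] (Config m n → ℝ) where
  toFun f η := generator m n p f η + f fun _ => false
  map_add' f g := by
    funext η
    simp only [generator_eq_sum hmn, Pi.add_apply, add_sub_add_comm, mul_add,
      Finset.sum_add_distrib]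
    ring
  map_smul' c f := by
    funext η
    simp only [generator_eq_sum hmn, Pi.smul_apply, smul_eq_mul, RingHom.id_apply, ← mul_sub,
      mul_left_comm _ c, ← Finset.mul_sum]
    ring

lemma shiftedGenerator_apply (hmn : m ≤ n) (p : ℤ → ℝ) (f : Config m n → ℝ) (η : Config m n) :
    shiftedGenerator hmn p f η = generator m n p f η + f fun _ => false := rfl

lemma generator_neg (hmn : m ≤ n) (p : ℤ → ℝ) (f : Config m n → ℝ) (η : Config m n) :
    generator m n p (-f) η = -generator m n p f η := by
  have := congrFun (map_neg (shiftedGenerator hmn p) f) η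
  simp only [Pi.neg_apply, shiftedGenerator_apply] at this
  linarith

lemma shiftedGenerator_injective (hmn : m ≤ n) {p : ℤ → ℝ}
    (hp : ∀ i ∈ Set.Icc (m - 1) n, p i ∈ Set.Ioo (0 : ℝ) 1) :
    Function.Injective (shiftedGenerator hmn p) := by
  rw [injective_iff_map_eq_zero]
  intro f hf
  have hL : ∀ η, generator m n p f η + f (fun _ => false) = 0 := fun η => congrFun hf η
  obtain ⟨η, hη⟩ := Finite.exists_max f
  obtain ⟨ζ, hζ⟩ := Finite.exists_max (-f)
  have h1 := generator_nonpos_of_max hmn hp hη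
  have h2 := generator_nonpos_of_max hmn hp hζ
  rw [generator_neg hmn] at h2
  have h0 : f (fun _ => false) = 0 := by linarith [hL η, hL ζ]
  have hz : ∀ ξ, generator m n p f ξ = 0 := fun ξ => by linarith [hL ξ]
  funext ξ
  have hle := le_empty_of_generator_nonneg hmn hp (fun ξ => (hz ξ).ge) ξ
  have hge := le_empty_of_generator_nonneg hmn hp (f := -f)
    (fun ξ => by rw [generator_neg hmn, hz, neg_zero]) ξ
  simp only [Pi.neg_apply] at hge
  simp only [Pi.zero_apply]
  linarith

lemma existsUnique_isStationary (hmn : m ≤ n) {p : ℤ → ℝ}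
    (hp : ∀ i ∈ Set.Icc (m - 1) n, p i ∈ Set.Ioo (0 : ℝ) 1) :
    ∃! μ : Config m n → ℝ, IsStationary m n p μ := by
  classical
  have hinj := shiftedGenerator_injective hmn hp
  let T := LinearEquiv.ofInjectiveEndo _ hinj
  have hT : ∀ f η, T f η = generator m n p f η + f fun _ => false := fun f η => rfl
  have hconst : ∀ c : ℝ, T (fun _ => c) = fun _ => c := by
    intro c
    funext η
    rw [hT, generator_eq_sum hmn]
    simp
  let φ : (Config m n → ℝ) →ₗ[ℝ] ℝ :=
    LinearMap.proj (fun _ => false) ∘ₗ (T.symm : (Config m n → ℝ) →ₗ[ℝ] (Config m n → ℝ))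
  have hφ : ∀ g, φ g = T.symm g fun _ => false := fun g => rfl
  have hφT : ∀ g η, g η = generator m n p (T.symm g) η + φ g := by
    intro g η
    rw [hφ, ← hT, LinearEquiv.apply_symm_apply]
  have hsum : ∀ g, ∑ η, φ (Pi.single η 1) * g η = φ g := by
    intro g
    rw [LinearMap.pi_apply_eq_sum_univ φ g]
    refine Finset.sum_congr rfl fun η _ => ?_
    rw [smul_eq_mul, mul_comm]
    congr 2
    funext ζ
    simp [Pi.single_apply, eq_comm]
  refine ⟨fun η => φ (Pi.single η 1), ⟨⟨fun η => ?_, ?_⟩, fun f => ?_⟩, fun μ hμ => ?_⟩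
  · -- At a maximum of the preimage of `g ≥ 0`, the generator is nonpositive, so `φ g ≥ 0`.
    obtain ⟨ζ, hζ⟩ := Finite.exists_max (T.symm (Pi.single η 1))
    have h1 := generator_nonpos_of_max hmn hp hζ
    have h2 := hφT (Pi.single η 1) ζ
    have h3 : (0 : ℝ) ≤ (Pi.single η 1 : Config m n → ℝ) ζ := by
      rw [Pi.single_apply]; split_ifs <;> simp
    change 0 ≤ φ (Pi.single η 1)
    linarith
  · have h := hsum fun _ => 1
    rw [hφ, (LinearEquiv.symm_apply_eq T).2 (hconst 1).symm] at h
    simpa using h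
  · rw [hsum]
    have h : T.symm (generator m n p f) = f - fun _ => f fun _ => false := by
      rw [LinearEquiv.symm_apply_eq, map_sub, hconst]
      funext η
      rw [Pi.sub_apply, hT, add_sub_cancel_right]
    rw [hφ, h, Pi.sub_apply, sub_self]
  · funext ξ
    have h : ∑ η, μ η * (Pi.single ξ 1 : Config m n → ℝ) η = φ (Pi.single ξ 1) := by
      simp only [hφT (Pi.single ξ 1), mul_add, Finset.sum_add_distrib, hμ.2]
      rw [← Finset.sum_mul, hμ.1.2, zero_add, one_mul]
    simpa [Pi.single_apply] using h

end OpenExclusion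

theorem theorem2 (m n : ℤ) (hmn : m ≤ n) :
    -- existence and uniqueness of the stationary distribution
    (∀ p : ℤ → ℝ, (∀ i ∈ Set.Icc (m - 1) n, p i ∈ Set.Ioo (0 : ℝ) 1) →
      ∃! μ : OpenExclusion.Config m n → ℝ, OpenExclusion.IsStationary m n p μ) ∧
    -- its flux does not depend on the bond
    (∀ p : ℤ → ℝ, (∀ i ∈ Set.Icc (m - 1) n, p i ∈ Set.Ioo (0 : ℝ) 1) →
      ∀ μ : OpenExclusion.Config m n → ℝ, OpenExclusion.IsStationary m n p μ →
        ∀ k ∈ Set.Icc (m - 1) n, ∀ l ∈ Set.Icc (m - 1) n,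
          OpenExclusion.flux p μ k = OpenExclusion.flux p μ l) ∧
    -- its flux is increasing in the jump probabilities
    (∀ p p' : ℤ → ℝ, (∀ i ∈ Set.Icc (m - 1) n, p i ∈ Set.Ioo (0 : ℝ) 1) →
      (∀ i ∈ Set.Icc (m - 1) n, p' i ∈ Set.Ioo (0 : ℝ) 1) →
      (∀ i ∈ Set.Icc (m - 1) n, p i ≤ p' i) →
      ∀ μ μ' : OpenExclusion.Config m n → ℝ,
        OpenExclusion.IsStationary m n p μ → OpenExclusion.IsStationary m n p' μ' →
        ∀ k ∈ Set.Icc (m - 1) n, OpenExclusion.flux p μ k ≤ OpenExclusion.flux p' μ' k) := by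
  refine ⟨fun p hp => OpenExclusion.existsUnique_isStationary hmn hp, ?_, ?_⟩
  · intro p _ μ hμ k hk l hl
    rw [hμ.flux_eq hmn hk.1 hk.2, hμ.flux_eq hmn hl.1 hl.2]
  · intro p p' hp hp' hle μ μ' hμ hμ' k hk
    rw [hμ.flux_eq hmn hk.1 hk.2, hμ'.flux_eq hmn hk.1 hk.2]
    exact OpenExclusion.flux_last_le hmn hp hp' hle hμ hμ'
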